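/- **Setting.** Let $P$ be a simple polygon in the plane (identified with its closed region) with a given triangulation $G$: nondegenerate triangles spanned by vertices of $P$, covering $P$, using all its vertices, and meeting only in common faces. A set of guards $\mathbb G$ is deployed on pairwise different edges of triangles: guard $g_i$ moves along the edge $h_i$, of length $l_i$. A triangle is *safe* if some $h_i$ is one of its edges, otherwise *non-safe*. For a triangle $T$, $\mathbb G(T)$ is the set of guards $g_i$ such that an endpoint of $h_i$ is a vertex of $T$. If $v$ is an endpoint of $h_i$, the non-safe triangles with vertex $v$ are called the non-safe triangles of $g_i$ at $v$. The distance $d(x,y)$ is the length of a shortest path from $x$ to $y$ in the visibility graph on the vertices of $P$ and $x,y$ (edges: segments contained in $P$); $d(A,B)=\inf_{x\in A,\,y\in B}d(x,y)$, which is $\infty$ if $A$ or $B$ is empty. Let $r>0$ be the speed ratio and $d_I^i=l_i/r$. **Guard adjacency graph.** $G^{\#}$ is the multigraph whose vertices are the non-safe triangles, with one edge $e_{j,k}(g_i)$ between $T_j$ and $T_k$ for each guard $g_i$, each non-safe triangle $T_j$ at one endpoint of $h_i$ and each non-safe triangle $T_k$ at the other. It is a forest if it has no cycle; two parallel edges count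 as a cycle of length $2$. **Feasible allocation.** A feasible partition and allocation for $r$ is a partition of each non-safe triangle $T_j$ into pairwise disjoint (possibly empty) regions $R_j(i)$, assigned to the guards $g_i\in\mathbb G(T_j)$, such that for each guard $g_i$ the unions $U$, $U'$ of the regions assigned to it in the non-safe triangles at the two endpoints of $h_i$ satisfy $l_i/d(U,U')\le r$ (where $l_i/\infty=0$ and $l_i/0=\infty$). **GENALLOC.** The algorithm labels, for each guard it processes, the endpoints of $h_i$ as $v_1(i)$, $v_2(i)$ and defines regions $R^1_j(i)\subseteq T_j$ for the non-safe $T_j$ at $v_1(i)$ and $R^2_j(i)\subseteq T_j$ for the non-safe $T_j$ at $v_2(i)$. It keeps a set $\mathbb G_{ready}$ of waiting guards and a set $\mathbb G_{alloc}$ of processed guards, both initially empty. * *Update $\mathbb G_{ready}$* (done at the start and after each of the following steps): every guard $g_i\notin\mathbb G_{ready}\cup\mathbb G_{alloc}$ that has an endpoint such that for every non-safe $T_j$ at it the regions $R_j^2(k)$ of all other guards $g_k\in\mathbb G(T_j)$ (not counting those whose edges at $T_j$ were deleted) are already defined is put into $\mathbb G_{ready}$, and such an endpoint is labelled $v_1(i)$.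 * *If $\mathbb G_{ready}\ne\emptyset$*, choose any $g_i\in\mathbb G_{ready}$ and call LOCALLOC: for each non-safe $T_j$ at $v_1(i)$ set $R_j^1(i)=T_j\setminus\bigcup_{g_k\in\mathbb G(T_j)\setminus\{g_i\}}R_j^2(k)$; let $U_i$ be the union of these regions; for each non-safe $T_j$ at $v_2(i)$ let $R_j^2(i)$ be the set of those points $x$ of $T_j$ not yet assigned to a guard for which $d(p,x)\ge d_I^i$ for all $p\in U_i$. (Triangles at which the edges of $g_i$ were deleted are skipped.) If for one of the latter $T_j$ the regions $R_j^2(k)$ are now defined for all $g_k\in\mathbb G(T_j)$ and they do not cover $T_j$, the algorithm halts with the answer that the allocation is not possible. Otherwise $g_i$ is moved from $\mathbb G_{ready}$ to $\mathbb G_{alloc}$. * *If $\mathbb G_{ready}=\emptyset$ and $\mathbb G_{alloc}\neq\mathbb G$*, ARBITALLOC chooses any $g_i\notin\mathbb G_{alloc}$ and any endpoint of $h_i$ as $v_1(i)$, deletes from $G^{\#}$, for each non-safe $T_k$ at $v_1(i)$, all edges incident to $T_k$ that correspond to other guards outside $\mathbb G_{alloc}$, and puts $g_i$ into $\mathbb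 G_{ready}$. * *If $\mathbb G_{ready}=\emptyset$ and $\mathbb G_{alloc}=\mathbb G$*, the algorithm halts and returns the regions $R_j^1(i)$, $R_j^2(i)$. **Lemma.** If $G^{\#}$ is a forest, then GENALLOC is complete: every execution terminates and, if a feasible partition and allocation of the non-safe triangles exists for the given $r$, then every execution, whatever choices are made, halts by returning one. -/

import Mathlib

namespace GuardTracking

/-! ### Polygons, triangulations, geodesic distance -/

/-- The Euclidean plane. -/
abbrev Plane : Type := EuclideanSpace ℝ (Fin 2)

/-- A polygon is simple if its vertices are distinct and two different edges meet only in a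
common endpoint of cyclically consecutive edges (`finRotate n` is the cyclic successor). -/
structure IsSimplePolygon {n : ℕ} (P : Polygon Plane n) : Prop where
  three_le : 3 ≤ n
  injective : Function.Injective P.vertices
  inter : ∀ i j : Fin n, i ≠ j → ∀ x ∈ P.edgeSet ℝ i ∩ P.edgeSet ℝ j,
    (j = finRotate n i ∧ x = P j) ∨ (i = finRotate n j ∧ x = P i)

/-- The closed region enclosed by the polygon: the boundary together with the points whose
connected component in the complement of the boundary is bounded. -/
def region {n : ℕ} (P : Polygon Plane n) : Set Plane :=
  P.boundary ℝ ∪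
    {x | x ∉ P.boundary ℝ ∧ Bornology.IsBounded (connectedComponentIn (P.boundary ℝ)ᶜ x)}

/-- The closed triangle (or segment, or point) spanned by a set of vertices of the polygon. -/
def hull {n : ℕ} (P : Polygon Plane n) (t : Finset (Fin n)) : Set Plane :=
  convexHull ℝ (P.vertices '' (t : Set (Fin n)))

/-- A triangulation of the polygonal region: nondegenerate triangles spanned by vertices of the
polygon, which cover the region, use every vertex, and meet only in common faces. -/
structure Triangulation {n : ℕ} (P : Polygon Plane n) where
  faces : Finset (Finset (Fin n))
  card_eq : ∀ t ∈ faces, t.card = 3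
  indep : ∀ t ∈ faces, AffineIndependent ℝ (fun i : t => P i)
  inter : ∀ s ∈ faces, ∀ t ∈ faces, hull P s ∩ hull P t = hull P (s ∩ t)
  cover : ⋃ t ∈ faces, hull P t = region P
  vertex_mem : ∀ i : Fin n, ∃ t ∈ faces, i ∈ t

/-- The visibility graph constructed from the vertices of the polygon and the points `x`, `y`:
two distinct nodes are adjacent if the segment joining them lies in the region. -/
def visibilityGraph {n : ℕ} (P : Polygon Plane n) (x y : Plane) : SimpleGraph Plane where
  Adj a b := a ≠ b ∧ a ∈ insert x (insert y (Set.range P.vertices)) ∧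
    b ∈ insert x (insert y (Set.range P.vertices)) ∧ segment ℝ a b ⊆ region P
  symm := ⟨fun a b h => ⟨h.1.symm, h.2.2.1, h.2.1, by rw [segment_symm]; exact h.2.2.2⟩⟩
  loopless := ⟨fun _ h => h.1 rfl⟩

/-- The Euclidean length of a walk. -/
noncomputable def walkLength {G : SimpleGraph Plane} {x y : Plane} (w : G.Walk x y) : ENNReal :=
  (w.darts.map fun e => edist e.fst e.snd).sum

/-- `d(x, y)`: the length of a shortest path from `x` to `y` on the visibility graph
(`⊤` if there is no path). -/
noncomputable def geoDist {n : ℕ} (P : Polygon Plane n) (x y : Plane) : ENNReal :=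
  ⨅ w : (visibilityGraph P x y).Walk x y, walkLength w

/-- `d(A, B)`: the distance between two sets of points (`⊤` if one of them is empty). -/
noncomputable def setDist {n : ℕ} (P : Polygon Plane n) (A B : Set Plane) : ENNReal :=
  ⨅ x ∈ A, ⨅ y ∈ B, geoDist P x y

/-! ### Guards -/

/-- A deployment of guards: the guard `i` moves along the diagonal `h_i` with endpoints
`ends i false` and `ends i true`, an edge of a triangle of the triangulation; different guards
have different diagonals. -/
structure Deployment {n : ℕ} {P : Polygon Plane n} (T : Triangulation P) (ι : Type*) where
  ends : ι → Bool → Fin n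
  ends_ne : ∀ i, ends i false ≠ ends i true
  diagonal : ∀ i, ∃ t ∈ T.faces, ends i false ∈ t ∧ ends i true ∈ t
  injective : Function.Injective fun i => s(ends i false, ends i true)

namespace Deployment

variable {n : ℕ} {P : Polygon Plane n} {T : Triangulation P} {ι : Type*}

/-- `l_i`, the length of the diagonal of the guard `i`. -/
noncomputable def len (D : Deployment T ι) (i : ι) : ℝ :=
  dist (P (D.ends i false)) (P (D.ends i true))

/-- The non-safe triangles: those that have no `h_i` as an edge. -/
def nonsafe (D : Deployment T ι) : Set (Finset (Fin n)) :=
  {t | t ∈ T.faces ∧ ¬ ∃ i, D.ends i false ∈ t ∧ D.ends i true ∈ t}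

/-- The non-safe triangles incident to the endpoint `a` of `h_i`. -/
def side (D : Deployment T ι) (i : ι) (a : Bool) : Set (Finset (Fin n)) :=
  {t | t ∈ D.nonsafe ∧ D.ends i a ∈ t}

/-- The guards incident to the triangle `t`. -/
def guardsAt (D : Deployment T ι) (t : Finset (Fin n)) : Set ι :=
  {i | ∃ a, D.ends i a ∈ t}

/-- The guard adjacency graph. It is a multigraph: its vertices are the non-safe triangles, and
there is one edge `(i, s, t)` between `s` and `t` for each guard `i` and all `s`, `t` incident
to the two different endpoints of `h_i`. -/
def guardAdjacencyGraph (D : Deployment T ι) :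
    Graph (Finset (Fin n)) (ι × Finset (Fin n) × Finset (Fin n)) where
  vertexSet := D.nonsafe
  IsLink e x y := e.2.1 ∈ D.side e.1 false ∧ e.2.2 ∈ D.side e.1 true ∧
    ((x = e.2.1 ∧ y = e.2.2) ∨ (x = e.2.2 ∧ y = e.2.1))
  isLink_symm := fun _ _ => ⟨fun _ _ h => ⟨h.1, h.2.1, h.2.2.elim
    (fun h => Or.inr ⟨h.2, h.1⟩) (fun h => Or.inl ⟨h.2, h.1⟩)⟩⟩
  eq_or_eq_of_isLink_of_isLink := by
    rintro e x y v w ⟨_, _, h⟩ ⟨_, _, h'⟩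
    rcases h with ⟨rfl, rfl⟩ | ⟨rfl, rfl⟩ <;> rcases h' with ⟨rfl, rfl⟩ | ⟨rfl, rfl⟩ <;> simp
  left_mem_of_isLink := by
    rintro e x y ⟨h₁, h₂, ⟨rfl, -⟩ | ⟨rfl, -⟩⟩
    exacts [h₁.1, h₂.1]

/-! ### Feasible allocations -/

/-- The union of the regions `A i t` over the non-safe triangles `t` incident to the endpoint
`a` of `h_i`: the part of the region of the guard `i` that it covers from that endpoint. -/
def unionAt (D : Deployment T ι) (A : ι → Finset (Fin n) → Set Plane) (i : ι) (a : Bool) :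
    Set Plane :=
  ⋃ t ∈ D.side i a, A i t

/-- The cost `l_i / d(U₁, U₂)` of the region allocated to the guard `i`, with the values
`0` if `d(U₁, U₂) = ⊤` (one of the two parts is empty) and `⊤` if `d(U₁, U₂) = 0`. -/
noncomputable def cost (D : Deployment T ι) (A : ι → Finset (Fin n) → Set Plane) (i : ι) :
    ENNReal :=
  ENNReal.ofReal (D.len i) / setDist P (D.unionAt A i false) (D.unionAt A i true)

/-- A feasible partition and allocation for the speed ratio `r`: each non-safe triangle `t` is
partitioned into regions `A i t` assigned to the guards `i` incident to it, and each guard has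
cost at most `r`. -/
structure IsFeasible (D : Deployment T ι) (r : ℝ) (A : ι → Finset (Fin n) → Set Plane) :
    Prop where
  eq_empty : ∀ i t, ¬ (t ∈ D.nonsafe ∧ i ∈ D.guardsAt t) → A i t = ∅
  cover : ∀ t ∈ D.nonsafe, ⋃ i, A i t = hull P t
  disjoint : ∀ t i k, i ≠ k → Disjoint (A i t) (A k t)
  cost_le : ∀ i, D.cost A i ≤ ENNReal.ofReal r

end Deployment

/-! ### The allocation algorithm -/

/-- Status of an execution: still running, returned with the answer that the allocation is not
possible, or returned with an allocation. -/
inductive Status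
  | running
  | impossible
  | allocated

/-- A state of GENALLOC, for guards `ι` and triangles `τ`. -/
structure State (ι τ : Type*) where
  /-- the set `G_ready` of guards that wait to be processed -/
  ready : Set ι
  /-- the set `G_alloc` of guards that have been processed -/
  alloc : Set ι
  /-- the endpoint of `h_i` that is labelled `v₁(i)`; meaningful once `i` has entered `ready` -/
  first : ι → Bool
  /-- the region `R_t¹(i)`, or `none` if it is not (yet) defined -/
  reg1 : ι → τ → Option (Set Plane)
  /-- the region `R_t²(i)`, or `none` if it is not (yet) defined -/
  reg2 : ι → τ → Option (Set Plane)
  /-- the pairs `(i, t)` such that ARBITALLOC has deleted from the guard adjacency graph the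
  edges incident to `t` that correspond to `i`: the guard `i` is no longer used for `t` -/
  deleted : Set (ι × τ)
  status : Status

namespace State

variable {ι τ : Type*}

/-- The region assigned to the guard `i` inside the triangle `t`. -/
def regions (s : State ι τ) (i : ι) (t : τ) : Set Plane :=
  (s.reg1 i t).getD ∅ ∪ (s.reg2 i t).getD ∅

end State

namespace Deployment

variable {n : ℕ} {P : Polygon Plane n} {T : Triangulation P} {ι : Type*}

/-- The criterion for the guard `i` to be ready with preferential endpoint `a`: at each non-safe
triangle incident to that endpoint, the regions `R_t²(k)` of all other guards `k` (those whose
edges at `t` have not been deleted) are already defined. -/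
def ReadyAt (D : Deployment T ι) (s : State ι (Finset (Fin n))) (i : ι) (a : Bool) : Prop :=
  ∀ t ∈ D.side i a, ∀ k ∈ D.guardsAt t, k ≠ i → (k, t) ∉ s.deleted → (s.reg2 k t).isSome

/-- `s'` results from `s` by the instruction "update `G_ready`": all guards outside
`ready ∪ alloc` that meet the criterion at some endpoint enter `ready`, and such an endpoint is
labelled `v₁` (if both endpoints qualify, the choice between them is arbitrary). -/
def Update (D : Deployment T ι) (s s' : State ι (Finset (Fin n))) : Prop :=
  ∃ f : ι → Bool,
    (∀ i, (i ∉ s.ready ∪ s.alloc ∧ ∃ a, D.ReadyAt s i a) → D.ReadyAt s i (f i)) ∧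
    (∀ i, ¬ (i ∉ s.ready ∪ s.alloc ∧ ∃ a, D.ReadyAt s i a) → f i = s.first i) ∧
    s' = { s with
      ready := s.ready ∪ {i | i ∉ s.ready ∪ s.alloc ∧ ∃ a, D.ReadyAt s i a}
      first := f }

/-- `T_t^free`: the part of the triangle `t` that has not yet been assigned to a guard. -/
def free (P : Polygon Plane n) (s : State ι (Finset (Fin n))) (t : Finset (Fin n)) :
    Set Plane :=
  hull P t \ ⋃ k, s.regions k t

open Classical in
/-- The first half of LOCALLOC: for each non-safe triangle `t` at `v₁(i)`, the region `R_t¹(i)`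
is the part of `t` that lies in none of the regions `R_t²(k)` of the other guards. -/
noncomputable def computeFirst (D : Deployment T ι) (s : State ι (Finset (Fin n))) (i : ι) :
    State ι (Finset (Fin n)) :=
  { s with
    reg1 := fun k t =>
      if k = i ∧ t ∈ D.side i (s.first i) ∧ (i, t) ∉ s.deleted then
        some (hull P t ∩ ⋂ m ∈ D.guardsAt t \ {i}, ((s.reg2 m t).getD ∅)ᶜ)
      else s.reg1 k t }

open Classical in
/-- The second half of LOCALLOC: for each non-safe triangle `t` at `v₂(i)`, the region `R_t²(i)`
is the set of points of `T_t^free` that lie outside the open balls of radius `d_I^i = l_i / r`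
around all points of `U₁`, the union of the regions `R_t¹(i)` (all of `T_t^free` if `U₁` is
empty). -/
noncomputable def computeSecond (D : Deployment T ι) (r : ℝ) (s : State ι (Finset (Fin n)))
    (i : ι) : State ι (Finset (Fin n)) :=
  { s with
    reg2 := fun k t =>
      if k = i ∧ t ∈ D.side i (!s.first i) ∧ (i, t) ∉ s.deleted then
        some {x | x ∈ free P s t ∧
          ∀ u ∈ D.side i (s.first i), ∀ p ∈ (s.reg1 i u).getD ∅,
            ENNReal.ofReal (D.len i / r) ≤ geoDist P p x}
      else s.reg2 k t }

/-- The state of the regions after LOCALLOC has been called for the guard `i`. -/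
noncomputable def localloc (D : Deployment T ι) (r : ℝ) (s : State ι (Finset (Fin n))) (i : ι) :
    State ι (Finset (Fin n)) :=
  D.computeSecond r (D.computeFirst s i) i

/-- `R_∅(t)`: the part of the triangle `t` that lies in none of the regions `R_t²(k)`. -/
def uncovered (D : Deployment T ι) (s : State ι (Finset (Fin n))) (t : Finset (Fin n)) :
    Set Plane :=
  hull P t ∩ ⋂ k ∈ D.guardsAt t, ((s.reg2 k t).getD ∅)ᶜ

/-- LOCALLOC, called for the guard `i`, returns True: after the computation of the regions of `i`
(with result `s`), there is a triangle `t` at `v₂(i)` for which `R_t²(k)` is defined for all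
guards `k` incident to `t` while `R_∅(t)` is not empty. -/
def Stop (D : Deployment T ι) (s : State ι (Finset (Fin n))) (i : ι) : Prop :=
  ∃ t ∈ D.side i (!s.first i), (i, t) ∉ s.deleted ∧
    (∀ k ∈ D.guardsAt t, (s.reg2 k t).isSome) ∧ (D.uncovered s t).Nonempty

/-- The state before the first update: nothing is assigned. -/
def blank (ι τ : Type*) : State ι τ where
  ready := ∅
  alloc := ∅
  first := fun _ => false
  reg1 := fun _ _ => none
  reg2 := fun _ _ => none
  deleted := ∅
  status := Status.running

/-- One step of GENALLOC. -/
inductive Step (D : Deployment T ι) (r : ℝ) :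
    State ι (Finset (Fin n)) → State ι (Finset (Fin n)) → Prop
  /-- A guard in `ready` is chosen, and LOCALLOC succeeds. -/
  | serve (s s' : State ι (Finset (Fin n))) (i : ι) (running : s.status = Status.running)
      (mem : i ∈ s.ready) (ok : ¬ D.Stop (D.localloc r s i) i)
      (update : D.Update { D.localloc r s i with
        ready := s.ready \ {i}
        alloc := insert i s.alloc } s') : Step D r s s'
  /-- A guard in `ready` is chosen, and LOCALLOC finds a region that cannot be assigned. -/
  | fail (s : State ι (Finset (Fin n))) (i : ι) (running : s.status = Status.running)
      (mem : i ∈ s.ready) (found : D.Stop (D.localloc r s i) i) :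
      Step D r s { D.localloc r s i with status := Status.impossible }
  /-- No guard is ready, but some are not allocated: ARBITALLOC chooses one of them and one of
  its endpoints, deletes the edges of the other unallocated guards at the triangles incident to
  this endpoint, and the chosen guard becomes ready. -/
  | arbit (s s' : State ι (Finset (Fin n))) (i : ι) (a : Bool)
      (running : s.status = Status.running) (noReady : s.ready = ∅) (unallocated : i ∉ s.alloc)
      (update : D.Update { s with
        ready := {i}
        first := fun k => (open Classical in if k = i then a else s.first k)
        deleted := s.deleted ∪
          {q | q.2 ∈ D.side i a ∧ q.1 ∈ D.guardsAt q.2 ∧ q.1 ∉ s.alloc ∧ q.1 ≠ i} } s') :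
      Step D r s s'
  /-- All guards are allocated: GENALLOC returns the regions. -/
  | finish (s : State ι (Finset (Fin n))) (running : s.status = Status.running)
      (noReady : s.ready = ∅) (all : ∀ i, i ∈ s.alloc) :
      Step D r s { s with status := Status.allocated }

/-- The states in which an execution of GENALLOC may start its main loop. -/
def IsInitial (D : Deployment T ι) (s : State ι (Finset (Fin n))) : Prop :=
  D.Update (blank ι (Finset (Fin n))) s

/-- `s` occurs in some execution of GENALLOC for the speed ratio `r`. -/
def Reachable (D : Deployment T ι) (r : ℝ) (s : State ι (Finset (Fin n))) : Prop :=
  ∃ s₀, D.IsInitial s₀ ∧ Relation.ReflTransGen (D.Step r) s₀ s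

/-- There is no infinite execution of GENALLOC for the speed ratio `r`. -/
def Terminates (D : Deployment T ι) (r : ℝ) : Prop :=
  ¬ ∃ f : ℕ → State ι (Finset (Fin n)), D.IsInitial (f 0) ∧ ∀ m, D.Step r (f m) (f (m + 1))

theorem exists_update (D : Deployment T ι) (s : State ι (Finset (Fin n))) :
    ∃ s', D.Update s s' := by
  classical
  exact ⟨_, fun i => if h : i ∉ s.ready ∪ s.alloc ∧ ∃ a, D.ReadyAt s i a then h.2.choose
    else s.first i, fun i h => by
      show D.ReadyAt s i (dite _ _ _)
      rw [dif_pos h]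
      exact h.2.choose_spec,
    fun i h => dif_neg h, rfl⟩

/-- GENALLOC is complete for the given input: executions exist, every execution terminates, and
if a feasible allocation exists, then every execution returns one, whatever choices are made. -/
def GenallocComplete (D : Deployment T ι) (r : ℝ) : Prop :=
  (∃ s, D.IsInitial s) ∧ D.Terminates r ∧
    ((∃ A, D.IsFeasible r A) →
      ∀ s, D.Reachable r s → (¬ ∃ s', D.Step r s s') →
        s.status = Status.allocated ∧ D.IsFeasible r s.regions)

end Deployment

/-- A multigraph is a forest if it has no cycle: there are no `m ≥ 1`, distinct vertices
`v 0, …, v (m - 1)` and distinct edges `e 0, …, e (m - 1)` such that `e j` joins `v j` to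
`v (j + 1)` with `v m = v 0`. A loop (`m = 1`) or two parallel edges (`m = 2`) form a cycle. -/
def IsForest {α β : Type*} (G : Graph α β) : Prop :=
  ¬ ∃ (m : ℕ) (v : ℕ → α) (e : ℕ → β), 1 ≤ m ∧ v m = v 0 ∧
    Set.InjOn v (Set.Iio m) ∧ Set.InjOn e (Set.Iio m) ∧
    ∀ j < m, G.IsLink (e j) (v j) (v (j + 1))

end GuardTracking

/-!
The theorem rests on two observations.

*ARBITALLOC is never called.* Suppose that no guard is ready and let `N ≠ ∅` be the set of
unallocated guards. An allocated guard that shares a triangle `t` with an unallocated one has a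
defined region `R_t²`, so readiness depends on `N` only: every guard of `N` has, at each of its
endpoints, a non-safe triangle which is incident to another guard of `N`. Hence one can walk forever
in the guard adjacency graph, entering a triangle along an edge of one guard and leaving it along an
edge of a different guard. Such a walk in a finite graph runs into a cycle: a shortest closed
segment of it has distinct vertices, and also distinct edges, because consecutive edges differ
(`not_isForest_of_walk`). So in a forest nothing is ever deleted (`exists_forall_notMem_guardsAt`,
`Consistent.false_of_ready_eq_empty`), every step but the last allocates one more of the finitely
many guards, and the execution terminates.

*The greedy choice is optimal.* Let `A` be a feasible allocation. By induction along the execution,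
`R_t¹(i) ⊆ A i t`, while `A i t` lies in the union of the regions `R_t²(k)` as soon as `R_t²(i)` is
defined (`Dominates`). Indeed `R_t¹(i)` is what all other guards at `t` leave over, and the smaller
the part of a guard at its first endpoint, the larger the part it can take at the second one. Since
`A` covers each triangle, LOCALLOC never finds an uncovered point, and the regions returned at the
end form a cover; their disjointness and their cost bounds hold by construction (`Consistent`).
-/

namespace GuardTracking

/-! ### Cycles in finite multigraphs -/

/-- An infinite walk in a finite multigraph whose consecutive edges differ contains a cycle. -/
theorem not_isForest_of_walk {α β : Type*} [Finite α] {G : Graph α β} (v : ℕ → α) (e : ℕ → β)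
    (link : ∀ j, G.IsLink (e j) (v j) (v (j + 1))) (ne : ∀ j, e j ≠ e (j + 1)) :
    ¬ IsForest G := by
  classical
  have key : ∃ m, 1 ≤ m ∧ ∃ p, v (p + m) = v p := by
    obtain ⟨a, b, hab, h⟩ := Finite.exists_ne_map_eq_of_infinite v
    rcases lt_or_gt_of_ne hab with hlt | hlt
    · exact ⟨b - a, by omega, a, by rw [Nat.add_sub_cancel' hlt.le, h]⟩
    · exact ⟨a - b, by omega, b, by rw [Nat.add_sub_cancel' hlt.le, h]⟩
  -- A closed segment of minimal length `m` of the walk, starting at the time `p`.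
  obtain ⟨m, ⟨hm, p, hp⟩, hmin⟩ : ∃ m, (1 ≤ m ∧ ∃ p, v (p + m) = v p) ∧
      ∀ m' < m, ¬ (1 ≤ m' ∧ ∃ p, v (p + m') = v p) :=
    ⟨Nat.find key, Nat.find_spec key, fun _ => Nat.find_min key⟩
  have vne : ∀ a b, a < b → b < a + m → v a ≠ v b := fun a b hab hb h =>
    hmin (b - a) (by omega) ⟨by omega, a, by rw [Nat.add_sub_cancel' hab.le, h]⟩
  have ene : ∀ a b, p ≤ a → a < b → b < p + m → e a ≠ e b := by
    intro a b ha hab hb h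
    have hb' := link b
    rw [← h] at hb'
    have h₁ : v (a + 1) = v b := by
      rcases G.eq_or_eq_of_isLink_of_isLink hb' (link a) with h | h
      · exact absurd h.symm (vne a b hab (by omega))
      · exact h.symm
    rcases eq_or_lt_of_le (Nat.succ_le_of_lt hab) with h' | h'
    · exact ne a (by rw [h, ← h'])
    · exact vne _ _ h' (by omega) h₁
  refine fun hG => hG ⟨m, fun j => v (p + j), fun j => e (p + j), hm, hp, ?_, ?_,
    fun j _ => link (p + j)⟩
  · intro a ha b hb h
    simp only [Set.mem_Iio] at ha hb
    rcases lt_trichotomy a b with hab | hab | hab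
    · exact absurd h (vne _ _ (by omega) (by omega))
    · exact hab
    · exact absurd h.symm (vne _ _ (by omega) (by omega))
  · intro a ha b hb h
    simp only [Set.mem_Iio] at ha hb
    rcases lt_trichotomy a b with hab | hab | hab
    · exact absurd h (ene _ _ (by omega) (by omega) (by omega))
    · exact hab
    · exact absurd h.symm (ene _ _ (by omega) (by omega) (by omega))

/-! ### Geodesic distance and cost -/

theorem visibilityGraph_comm {n : ℕ} (P : Polygon Plane n) (x y : Plane) :
    visibilityGraph P x y = visibilityGraph P y x := by
  ext a b
  simp only [visibilityGraph, Set.insert_comm x y]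

theorem walkLength_reverse {G : SimpleGraph Plane} {x y : Plane} (w : G.Walk x y) :
    walkLength w.reverse = walkLength w := by
  simp only [walkLength, SimpleGraph.Walk.darts_reverse, List.map_reverse, List.map_map,
    List.sum_reverse]
  congr 2
  funext e
  exact edist_comm _ _

theorem geoDist_comm {n : ℕ} (P : Polygon Plane n) (x y : Plane) :
    geoDist P x y = geoDist P y x := by
  have h : ∀ x y, geoDist P x y ≤ geoDist P y x := by
    intro x y
    unfold geoDist
    rw [visibilityGraph_comm P y x]
    exact le_iInf fun w => (iInf_le _ w.reverse).trans_eq (walkLength_reverse w)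
  exact le_antisymm (h x y) (h y x)

namespace Deployment

variable {n : ℕ} {P : Polygon Plane n} {T : Triangulation P} {ι : Type*} {D : Deployment T ι}
  {r : ℝ} {s s' : State ι (Finset (Fin n))} {A : ι → Finset (Fin n) → Set Plane}

/-- The cost bound, read from either endpoint `a`, says that the two parts of the region of a
guard are at distance at least `l_i / r`. -/
theorem cost_le_iff (hr : 0 < r) (i : ι) (a : Bool) :
    D.cost A i ≤ ENNReal.ofReal r ↔ ∀ p ∈ D.unionAt A i a, ∀ x ∈ D.unionAt A i (!a),
      ENNReal.ofReal (D.len i / r) ≤ geoDist P p x := by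
  have h : D.cost A i ≤ ENNReal.ofReal r ↔ ∀ p ∈ D.unionAt A i false,
      ∀ x ∈ D.unionAt A i true, ENNReal.ofReal (D.len i / r) ≤ geoDist P p x := by
    have hr0 : ENNReal.ofReal r ≠ 0 := by simpa using hr
    rw [cost, ENNReal.div_le_iff_le_mul (Or.inr ENNReal.ofReal_ne_top) (Or.inr hr0),
      ENNReal.ofReal_div_of_pos hr, mul_comm,
      ← ENNReal.div_le_iff_le_mul (Or.inl hr0) (Or.inl ENNReal.ofReal_ne_top)]
    simp only [setDist, le_iInf_iff]
  rw [h]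
  cases a
  · rfl
  · exact ⟨fun h p hp x hx => geoDist_comm P x p ▸ h x hx p hp,
      fun h p hp x hx => geoDist_comm P x p ▸ h x hx p hp⟩

/-! ### Incidence of guards and triangles -/

theorem finite_guards (D : Deployment T ι) : Finite ι := Finite.of_injective _ D.injective

/-- A triangle incident to both endpoints of `h_i` is safe. -/
theorem notMem_side_not {i : ι} {a : Bool} {t : Finset (Fin n)} (h : t ∈ D.side i a) :
    t ∉ D.side i (!a) := by
  intro h'
  refine h.1.2 ⟨i, ?_⟩
  cases a
  · exact ⟨h.2, h'.2⟩
  · exact ⟨h'.2, h.2⟩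

theorem mem_guardsAt {i : ι} {a : Bool} {t : Finset (Fin n)} (h : t ∈ D.side i a) :
    i ∈ D.guardsAt t := ⟨a, h.2⟩

theorem mem_side_or {i : ι} {t : Finset (Fin n)} (ht : t ∈ D.nonsafe) (hi : i ∈ D.guardsAt t)
    (a : Bool) : t ∈ D.side i a ∨ t ∈ D.side i (!a) := by
  obtain ⟨b, hb⟩ := hi
  rcases Bool.eq_or_eq_not b a with rfl | rfl
  exacts [Or.inl ⟨ht, hb⟩, Or.inr ⟨ht, hb⟩]

/-- Every edge of the guard adjacency graph can be traversed from the side of either endpoint. -/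
theorem exists_isLink {k : ι} {b : Bool} {t u : Finset (Fin n)} (ht : t ∈ D.side k b)
    (hu : u ∈ D.side k (!b)) : ∃ e, e.1 = k ∧ D.guardAdjacencyGraph.IsLink e t u := by
  cases b
  · exact ⟨(k, t, u), rfl, ht, hu, Or.inl ⟨rfl, rfl⟩⟩
  · exact ⟨(k, u, t), rfl, hu, ht, Or.inr ⟨rfl, rfl⟩⟩

/-- In a forest, every nonempty set of guards has a member with an endpoint whose non-safe
triangles are incident to no other member. -/
theorem exists_forall_notMem_guardsAt (hD : IsForest D.guardAdjacencyGraph) {N : Set ι}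
    (hN : N.Nonempty) :
    ∃ i ∈ N, ∃ a, ∀ t ∈ D.side i a, ∀ k ∈ N, k ≠ i → k ∉ D.guardsAt t := by
  by_contra! h
  choose! tri htri nxt hnxt hne hmem using h
  have hend : ∀ i ∈ N, ∀ a, ∃ b, tri i a ∈ D.side (nxt i a) b := fun i hi a =>
    (mem_side_or (htri i hi a).1 (hmem i hi a) false).elim (fun h => ⟨_, h⟩) (fun h => ⟨_, h⟩)
  choose! fin hfin using hend
  obtain ⟨i₀, hi₀⟩ := hN
  -- The states of the walk: a guard of `N` and the endpoint towards which its edge is traversed.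
  let step : ι × Bool → ι × Bool := fun q => (nxt q.1 q.2, !fin q.1 q.2)
  let q : ℕ → ι × Bool := fun j => step^[j] (i₀, true)
  have hq : ∀ j, q (j + 1) = step (q j) := fun j => Function.iterate_succ_apply' _ _ _
  have hqN : ∀ j, (q j).1 ∈ N := by
    intro j
    induction j with
    | zero => exact hi₀
    | succ j ih => rw [hq]; exact hnxt _ ih _
  have hlink : ∀ j, ∃ e, e.1 = (q (j + 1)).1 ∧ D.guardAdjacencyGraph.IsLink e
      (tri (q j).1 (q j).2) (tri (q (j + 1)).1 (q (j + 1)).2) := by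
    intro j
    have h := htri _ (hqN (j + 1)) (q (j + 1)).2
    rw [hq] at h ⊢
    exact exists_isLink (hfin _ (hqN j) _) h
  choose e he hl using hlink
  refine not_isForest_of_walk _ e hl (fun j hj => ?_) hD
  have h : (q (j + 1 + 1)).1 = (q (j + 1)).1 := by rw [← he, ← he, hj]
  rw [hq (j + 1)] at h
  exact hne _ (hqN (j + 1)) _ h

/-! ### The invariants of an execution -/

/-- The properties of the states of a running execution in which nothing has been deleted. -/
structure Consistent (D : Deployment T ι) (r : ℝ) (s : State ι (Finset (Fin n))) : Prop where
  deleted : s.deleted = ∅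
  notMem_alloc : ∀ i ∈ s.ready, i ∉ s.alloc
  readyAt : ∀ i ∈ s.ready ∪ s.alloc, D.ReadyAt s i (s.first i)
  isSome_reg1 : ∀ k t, (s.reg1 k t).isSome ↔ k ∈ s.alloc ∧ t ∈ D.side k (s.first k)
  isSome_reg2 : ∀ k t, (s.reg2 k t).isSome ↔ k ∈ s.alloc ∧ t ∈ D.side k (!s.first k)
  subset_hull : ∀ k t, s.regions k t ⊆ hull P t
  cover : ∀ k ∈ s.alloc, ∀ t ∈ D.side k (s.first k), hull P t ⊆ ⋃ m, s.regions m t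
  disjoint : ∀ t i k, i ≠ k → Disjoint (s.regions i t) (s.regions k t)
  le_geoDist : ∀ k, ∀ t ∈ D.side k (s.first k), ∀ u, ∀ p ∈ (s.reg1 k t).getD ∅,
    ∀ x ∈ (s.reg2 k u).getD ∅, ENNReal.ofReal (D.len k / r) ≤ geoDist P p x

/-- No guard can be added to `ready`: the situation after each update. -/
def Saturated (D : Deployment T ι) (s : State ι (Finset (Fin n))) : Prop :=
  ∀ i, i ∉ s.ready ∪ s.alloc → ∀ a, ¬ D.ReadyAt s i a

/-- The execution is at least as good as the allocation `A` at the second endpoints: where `i` has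
chosen its region `R_t²(i)`, all of `A i t` has been taken, by `i` or by guards before it. -/
def Dominates (A : ι → Finset (Fin n) → Set Plane) (s : State ι (Finset (Fin n))) : Prop :=
  ∀ k t, (s.reg2 k t).isSome → A k t ⊆ ⋃ m, (s.reg2 m t).getD ∅

theorem isSome_of_mem_getD {o : Option (Set Plane)} {x : Plane} (h : x ∈ o.getD ∅) :
    o.isSome := by
  cases o
  exacts [h.elim, rfl]

theorem consistent_blank : D.Consistent r (blank ι (Finset (Fin n))) where
  deleted := rfl
  notMem_alloc _ h := h.elim
  readyAt _ h := by simp [blank] at h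
  isSome_reg1 := by simp [blank]
  isSome_reg2 := by simp [blank]
  subset_hull := by simp [blank, State.regions]
  cover _ h := h.elim
  disjoint := by simp [blank, State.regions]
  le_geoDist := by simp [blank]

theorem Update.saturated (h : D.Update s s') : D.Saturated s' := by
  obtain ⟨f, -, -, rfl⟩ := h
  intro i hi a ha
  have hi' : i ∉ s.ready ∪ s.alloc := fun h => hi (h.elim (fun h => Or.inl (Or.inl h)) Or.inr)
  exact hi (Or.inl (Or.inr ⟨hi', a, ha⟩))

theorem Consistent.update (hs : D.Consistent r s) (h : D.Update s s') : D.Consistent r s' := by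
  obtain ⟨f, hf, hf', rfl⟩ := h
  have first_eq : ∀ i ∈ s.ready ∪ s.alloc, f i = s.first i := fun i hi =>
    hf' i fun h => h.1 hi
  have alloc_eq : ∀ k ∈ s.alloc, f k = s.first k := fun k hk => first_eq k (Or.inr hk)
  refine ⟨hs.deleted, ?_, ?_, ?_, ?_, hs.subset_hull, ?_, hs.disjoint, ?_⟩
  · rintro i (hi | hi)
    exacts [hs.notMem_alloc i hi, fun h => hi.1 (Or.inr h)]
  · intro i hi
    by_cases hi' : i ∈ s.ready ∪ s.alloc
    · change D.ReadyAt s i (f i)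
      rw [first_eq i hi']
      exact hs.readyAt i hi'
    · rcases hi with (hi | hi) | hi
      exacts [absurd (Or.inl hi) hi', hf i hi, absurd (Or.inr hi) hi']
  · intro k t
    refine (hs.isSome_reg1 k t).trans (and_congr_right fun hk => ?_)
    simp only [alloc_eq k hk]
  · intro k t
    refine (hs.isSome_reg2 k t).trans (and_congr_right fun hk => ?_)
    simp only [alloc_eq k hk]
  · intro k hk t ht
    simp only [alloc_eq k hk] at ht
    exact hs.cover k hk t ht
  · intro k t ht u p hp x hx
    have hk := ((hs.isSome_reg1 k t).1 (isSome_of_mem_getD hp)).1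
    simp only [alloc_eq k hk] at ht
    exact hs.le_geoDist k t ht u p hp x hx

theorem Dominates.update (hs : Dominates A s) (h : D.Update s s') : Dominates A s' := by
  obtain ⟨f, -, -, rfl⟩ := h
  exact hs

/-- The guard that takes the rest of a triangle is the last one there. -/
theorem Consistent.mem_alloc (hs : D.Consistent r s) {i k : ι} {t : Finset (Fin n)}
    (hi : i ∈ s.ready ∪ s.alloc) (ht : t ∈ D.side i (s.first i)) (hk : k ∈ D.guardsAt t)
    (hki : k ≠ i) : (s.reg2 k t).isSome ∧ k ∈ s.alloc := by
  have h := hs.readyAt i hi t ht k hk hki (by simp [hs.deleted])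
  exact ⟨h, ((hs.isSome_reg2 k t).1 h).1⟩

/-- In a forest, ARBITALLOC is never called. -/
theorem Consistent.false_of_ready_eq_empty (hD : IsForest D.guardAdjacencyGraph)
    (hs : D.Consistent r s) (hsat : D.Saturated s) (hready : s.ready = ∅) {i : ι}
    (hi : i ∉ s.alloc) : False := by
  obtain ⟨j, hj, a, h⟩ := exists_forall_notMem_guardsAt hD (N := s.allocᶜ) ⟨i, hi⟩
  refine hsat j (by simpa [hready] using hj) a fun t ht k hk hkj _ => ?_
  have hka : k ∈ s.alloc := by
    by_contra hka
    exact h t ht k hka hkj hk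
  rcases mem_side_or ht.1 hk (s.first k) with h' | h'
  · exact absurd (hs.mem_alloc (Or.inr hka) h' (mem_guardsAt ht) hkj.symm).2 hj
  · exact (hs.isSome_reg2 k t).2 ⟨hka, h'⟩

/-! ### LOCALLOC -/

/-- The state after the guard `i` has been served and before the next update. -/
noncomputable def served (D : Deployment T ι) (r : ℝ) (s : State ι (Finset (Fin n))) (i : ι) :
    State ι (Finset (Fin n)) :=
  { D.localloc r s i with
    ready := s.ready \ {i}
    alloc := insert i s.alloc }

theorem served_reg1_of_ne {i k : ι} (h : k ≠ i) (t : Finset (Fin n)) :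
    (D.served r s i).reg1 k t = s.reg1 k t := by
  simp [served, localloc, computeSecond, computeFirst, h]

theorem served_reg2_of_ne {i k : ι} (h : k ≠ i) (t : Finset (Fin n)) :
    (D.served r s i).reg2 k t = s.reg2 k t := by
  simp [served, localloc, computeSecond, computeFirst, h]

theorem served_regions_of_ne {i k : ι} (h : k ≠ i) (t : Finset (Fin n)) :
    (D.served r s i).regions k t = s.regions k t := by
  simp only [State.regions, served_reg1_of_ne h, served_reg2_of_ne h]

theorem Consistent.reg1_eq_none (hs : D.Consistent r s) {i : ι} (hi : i ∉ s.alloc)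
    (t : Finset (Fin n)) : s.reg1 i t = none := by
  rw [← Option.not_isSome_iff_eq_none, hs.isSome_reg1]
  exact fun h => hi h.1

theorem Consistent.reg2_eq_none (hs : D.Consistent r s) {i : ι} (hi : i ∉ s.alloc)
    (t : Finset (Fin n)) : s.reg2 i t = none := by
  rw [← Option.not_isSome_iff_eq_none, hs.isSome_reg2]
  exact fun h => hi h.1

theorem Consistent.served_reg1_self (hs : D.Consistent r s) {i : ι}
    {t : Finset (Fin n)} (ht : t ∈ D.side i (s.first i)) :
    (D.served r s i).reg1 i t =
      some (hull P t ∩ ⋂ m ∈ D.guardsAt t \ {i}, ((s.reg2 m t).getD ∅)ᶜ) := by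
  simp [served, localloc, computeSecond, computeFirst, ht, hs.deleted]

theorem Consistent.served_reg1_eq_none (hs : D.Consistent r s) {i : ι} (hi : i ∉ s.alloc)
    {t : Finset (Fin n)} (ht : t ∉ D.side i (s.first i)) :
    (D.served r s i).reg1 i t = none := by
  simp [served, localloc, computeSecond, computeFirst, ht, hs.reg1_eq_none hi]

theorem Consistent.served_reg2_eq_none (hs : D.Consistent r s) {i : ι} (hi : i ∉ s.alloc)
    {t : Finset (Fin n)} (ht : t ∉ D.side i (!s.first i)) :
    (D.served r s i).reg2 i t = none := by
  simp [served, localloc, computeSecond, computeFirst, ht, hs.reg2_eq_none hi]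

theorem Consistent.served_reg2_self (hs : D.Consistent r s) {i : ι}
    {t : Finset (Fin n)} (ht : t ∈ D.side i (!s.first i)) :
    (D.served r s i).reg2 i t = some {x | x ∈ free P s t ∧ ∀ u ∈ D.side i (s.first i),
      ∀ p ∈ ((D.served r s i).reg1 i u).getD ∅,
        ENNReal.ofReal (D.len i / r) ≤ geoDist P p x} := by
  have ht' : t ∉ D.side i (s.first i) := by simpa using notMem_side_not ht
  have hfree : free P (D.computeFirst s i) t = free P s t := by
    simp [free, State.regions, computeFirst, ht']
  have h : (D.served r s i).reg2 i t = some {x | x ∈ free P (D.computeFirst s i) t ∧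
      ∀ u ∈ D.side i (s.first i), ∀ p ∈ ((D.served r s i).reg1 i u).getD ∅,
        ENNReal.ofReal (D.len i / r) ≤ geoDist P p x} := by
    have hdel : (i, t) ∉ s.deleted := by simp [hs.deleted]
    exact if_pos ⟨rfl, ht, hdel⟩
  rw [h, hfree]

theorem Consistent.served_regions_self (hs : D.Consistent r s) {i : ι} (hi : i ∉ s.alloc)
    {t : Finset (Fin n)} (ht : t ∈ D.side i (s.first i)) :
    (D.served r s i).regions i t =
      hull P t ∩ ⋂ m ∈ D.guardsAt t \ {i}, ((s.reg2 m t).getD ∅)ᶜ := by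
  simp [State.regions, hs.served_reg1_self ht, hs.served_reg2_eq_none hi (notMem_side_not ht)]

theorem Consistent.served_regions_subset_free (hs : D.Consistent r s) {i : ι} (hi : i ∉ s.alloc)
    {t : Finset (Fin n)} (ht : t ∉ D.side i (s.first i)) :
    (D.served r s i).regions i t ⊆ free P s t := by
  by_cases ht' : t ∈ D.side i (!s.first i)
  · simp only [State.regions, hs.served_reg1_eq_none hi ht, hs.served_reg2_self ht']
    rintro x (hx | hx)
    exacts [hx.elim, hx.1]
  · simp [State.regions, hs.served_reg1_eq_none hi ht, hs.served_reg2_eq_none hi ht']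

theorem Consistent.mem_guardsAt_of_mem_reg2 (hs : D.Consistent r s) {k : ι} {t : Finset (Fin n)}
    {x : Plane} (hx : x ∈ (s.reg2 k t).getD ∅) : k ∈ D.guardsAt t :=
  mem_guardsAt ((hs.isSome_reg2 k t).1 (isSome_of_mem_getD hx)).2

/-- Before the guard `i` is served, only regions `R_t²(k)` are assigned in its triangles. -/
theorem Consistent.mem_reg2_of_mem_regions (hs : D.Consistent r s) {i k : ι} (hi : i ∉ s.alloc)
    {t : Finset (Fin n)} (ht : i ∈ D.guardsAt t) {x : Plane} (hx : x ∈ s.regions k t) :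
    x ∈ (s.reg2 k t).getD ∅ := by
  rcases hx with hx | hx
  · obtain ⟨hk, htk⟩ := (hs.isSome_reg1 k t).1 (isSome_of_mem_getD hx)
    have hik : i ≠ k := fun h => hi (h ▸ hk)
    exact absurd (hs.mem_alloc (Or.inr hk) htk ht hik).2 hi
  · exact hx

theorem Consistent.disjoint_served (hs : D.Consistent r s) {i k : ι} (hi : i ∉ s.alloc)
    (hk : k ≠ i) (t : Finset (Fin n)) :
    Disjoint ((D.served r s i).regions i t) ((D.served r s i).regions k t) := by
  rw [served_regions_of_ne hk, Set.disjoint_left]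
  intro x hx hxk
  by_cases ht : t ∈ D.side i (s.first i)
  · have hx2 := hs.mem_reg2_of_mem_regions hi (mem_guardsAt ht) hxk
    rw [hs.served_regions_self hi ht] at hx
    exact Set.mem_iInter₂.1 hx.2 k ⟨hs.mem_guardsAt_of_mem_reg2 hx2, hk⟩ hx2
  · exact (hs.served_regions_subset_free hi ht hx).2 (Set.mem_iUnion.2 ⟨k, hxk⟩)

theorem Consistent.served (hs : D.Consistent r s) {i : ι} (hir : i ∈ s.ready) :
    D.Consistent r (D.served r s i) := by
  have hi := hs.notMem_alloc i hir
  have mono : ∀ k t, (s.reg2 k t).isSome → ((D.served r s i).reg2 k t).isSome := by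
    intro k t h
    have hk : k ≠ i := by
      rintro rfl
      exact hi ((hs.isSome_reg2 _ t).1 h).1
    rwa [served_reg2_of_ne hk]
  refine ⟨hs.deleted, ?_, ?_, ?_, ?_, ?_, ?_, ?_, ?_⟩
  · rintro k hk (rfl | hka)
    exacts [hk.2 rfl, hs.notMem_alloc k hk.1 hka]
  · intro k hk t ht m hm hmk hdel
    have hk' : k ∈ s.ready ∪ s.alloc := by
      rcases hk with hk | rfl | hk
      exacts [Or.inl hk.1, Or.inl hir, Or.inr hk]
    exact mono m t (hs.readyAt k hk' t ht m hm hmk hdel)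
  · intro k t
    change _ ↔ (k = i ∨ k ∈ s.alloc) ∧ t ∈ D.side k (s.first k)
    by_cases hk : k = i
    · subst hk
      by_cases ht : t ∈ D.side k (s.first k)
      · simp [hs.served_reg1_self ht, ht]
      · simp [hs.served_reg1_eq_none hi ht, ht]
    · rw [served_reg1_of_ne hk, hs.isSome_reg1]
      simp [hk]
  · intro k t
    change _ ↔ (k = i ∨ k ∈ s.alloc) ∧ t ∈ D.side k (!s.first k)
    by_cases hk : k = i
    · subst hk
      by_cases ht : t ∈ D.side k (!s.first k)
      · simp [hs.served_reg2_self ht, ht]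
      · simp [hs.served_reg2_eq_none hi ht, ht]
    · rw [served_reg2_of_ne hk, hs.isSome_reg2]
      simp [hk]
  · intro k t
    by_cases hk : k = i
    · subst hk
      by_cases ht : t ∈ D.side k (s.first k)
      · rw [hs.served_regions_self hi ht]
        exact Set.inter_subset_left
      · exact (hs.served_regions_subset_free hi ht).trans Set.sdiff_subset
    · rw [served_regions_of_ne hk]
      exact hs.subset_hull k t
  · intro k hk t ht x hx
    rcases hk with rfl | hk
    · by_cases hx' : ∃ m ∈ D.guardsAt t \ {k}, x ∈ (s.reg2 m t).getD ∅
      · obtain ⟨m, hm, hxm⟩ := hx'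
        refine Set.mem_iUnion.2 ⟨m, ?_⟩
        rw [served_regions_of_ne hm.2]
        exact Or.inr hxm
      · refine Set.mem_iUnion.2 ⟨k, ?_⟩
        rw [hs.served_regions_self hi ht]
        exact ⟨hx, Set.mem_iInter₂.2 fun m hm h => hx' ⟨m, hm, h⟩⟩
    · obtain ⟨m, hm⟩ := Set.mem_iUnion.1 (hs.cover k hk t ht hx)
      have hmi : m ≠ i := by
        rintro rfl
        simp [State.regions, hs.reg1_eq_none hi, hs.reg2_eq_none hi] at hm
      refine Set.mem_iUnion.2 ⟨m, ?_⟩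
      rwa [served_regions_of_ne hmi]
  · intro t j k hjk
    by_cases hj : j = i
    · subst hj
      exact hs.disjoint_served hi hjk.symm t
    · by_cases hk : k = i
      · subst hk
        exact (hs.disjoint_served hi hj t).symm
      · rw [served_regions_of_ne hj, served_regions_of_ne hk]
        exact hs.disjoint t j k hjk
  · intro k t ht u p hp x hx
    by_cases hk : k = i
    · subst hk
      by_cases hu : u ∈ D.side k (!s.first k)
      · rw [hs.served_reg2_self hu] at hx
        exact hx.2 t ht p hp
      · rw [hs.served_reg2_eq_none hi hu] at hx
        exact hx.elim
    · rw [served_reg1_of_ne hk] at hp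
      rw [served_reg2_of_ne hk] at hx
      exact hs.le_geoDist k t ht u p hp x hx

/-! ### Comparison with a feasible allocation -/

theorem IsFeasible.exists_mem (hA : D.IsFeasible r A) {t : Finset (Fin n)} (ht : t ∈ D.nonsafe)
    {x : Plane} (hx : x ∈ hull P t) : ∃ m ∈ D.guardsAt t, x ∈ A m t := by
  rw [← hA.cover t ht] at hx
  obtain ⟨m, hm⟩ := Set.mem_iUnion.1 hx
  refine ⟨m, ?_, hm⟩
  by_contra h
  rw [hA.eq_empty m t fun h' => h h'.2] at hm
  exact hm

/-- What the other guards leave over at the first endpoint of `i` is part of what `A` assigns to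
`i`. -/
theorem Dominates.served_reg1_subset (hA : D.IsFeasible r A) (hdom : Dominates A s)
    (hs : D.Consistent r s) {i : ι} (hir : i ∈ s.ready) {t : Finset (Fin n)}
    (ht : t ∈ D.side i (s.first i)) : ((D.served r s i).reg1 i t).getD ∅ ⊆ A i t := by
  intro x hx
  rw [hs.served_reg1_self ht] at hx
  obtain ⟨m, hm, hxm⟩ := hA.exists_mem ht.1 hx.1
  by_cases hmi : m = i
  · rwa [← hmi]
  · exfalso
    obtain ⟨m', hm'⟩ := Set.mem_iUnion.1
      (hdom m t (hs.mem_alloc (Or.inl hir) ht hm hmi).1 hxm)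
    have hne : m' ≠ i := by
      rintro rfl
      rw [hs.reg2_eq_none (hs.notMem_alloc _ hir)] at hm'
      exact hm'
    exact Set.mem_iInter₂.1 hx.2 m' ⟨hs.mem_guardsAt_of_mem_reg2 hm', hne⟩ hm'

theorem Dominates.served (hr : 0 < r) (hA : D.IsFeasible r A) (hdom : Dominates A s)
    (hs : D.Consistent r s) {i : ι} (hir : i ∈ s.ready) : Dominates A (D.served r s i) := by
  have hi := hs.notMem_alloc i hir
  have mono : ∀ t, ⋃ m, (s.reg2 m t).getD ∅ ⊆ ⋃ m, ((D.served r s i).reg2 m t).getD ∅ := by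
    intro t
    refine Set.iUnion_mono fun m => ?_
    by_cases hm : m = i
    · subst hm
      simp [hs.reg2_eq_none hi]
    · rw [served_reg2_of_ne hm]
  intro k t hk
  by_cases hki : k = i
  · subst hki
    have ht : t ∈ D.side k (!s.first k) := (((hs.served hir).isSome_reg2 k t).1 hk).2
    intro x hx
    have hxt : x ∈ hull P t := by
      rw [← hA.cover t ht.1]
      exact Set.mem_iUnion.2 ⟨k, hx⟩
    by_cases hfree : x ∈ free P s t
    · refine Set.mem_iUnion.2 ⟨k, ?_⟩
      rw [hs.served_reg2_self ht]
      refine ⟨hfree, fun u hu p hp => ?_⟩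
      exact (cost_le_iff hr k (s.first k)).1 (hA.cost_le k) p
        (Set.mem_iUnion₂.2 ⟨u, hu, hdom.served_reg1_subset hA hs hir hu hp⟩) x
        (Set.mem_iUnion₂.2 ⟨t, ht, hx⟩)
    · have hx' : x ∈ ⋃ m, s.regions m t := by
        by_contra h
        exact hfree ⟨hxt, h⟩
      obtain ⟨m, hm⟩ := Set.mem_iUnion.1 hx'
      exact mono t (Set.mem_iUnion.2
        ⟨m, hs.mem_reg2_of_mem_regions hi (mem_guardsAt ht) hm⟩)
  · rw [served_reg2_of_ne hki] at hk
    exact (hdom k t hk).trans (mono t)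

/-- If a feasible allocation exists, then LOCALLOC does not find an uncovered point. -/
theorem Dominates.localloc_succeeds (hr : 0 < r) (hA : D.IsFeasible r A) (hdom : Dominates A s)
    (hs : D.Consistent r s) {i : ι} (hir : i ∈ s.ready) : ¬ D.Stop (D.localloc r s i) i := by
  rintro ⟨t, ht, -, hsome, x, hx, hx'⟩
  obtain ⟨m, hm, hxm⟩ := hA.exists_mem ht.1 hx
  obtain ⟨k, hk⟩ := Set.mem_iUnion.1 (hdom.served hr hA hs hir m t (hsome m hm) hxm)
  exact Set.mem_iInter₂.1 hx' k ((hs.served hir).mem_guardsAt_of_mem_reg2 hk) hk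

/-- The regions returned when all guards are allocated form a feasible allocation. The existence
of `A` is used for the triangles that are at the second endpoint of all their guards. -/
theorem Consistent.isFeasible (hr : 0 < r) (hA : D.IsFeasible r A) (hdom : Dominates A s)
    (hs : D.Consistent r s) (all : ∀ i, i ∈ s.alloc) : D.IsFeasible r s.regions where
  eq_empty i t h := by
    refine Set.eq_empty_of_forall_notMem fun x hx => h ?_
    rcases hx with hx | hx
    · have ht := ((hs.isSome_reg1 i t).1 (isSome_of_mem_getD hx)).2
      exact ⟨ht.1, mem_guardsAt ht⟩
    · have ht := ((hs.isSome_reg2 i t).1 (isSome_of_mem_getD hx)).2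
      exact ⟨ht.1, mem_guardsAt ht⟩
  cover t ht := by
    refine Set.Subset.antisymm (Set.iUnion_subset fun k => hs.subset_hull k t) fun x hx => ?_
    obtain ⟨m, hm, hxm⟩ := hA.exists_mem ht hx
    rcases mem_side_or ht hm (s.first m) with h | h
    · exact hs.cover m (all m) t h hx
    · obtain ⟨k, hk⟩ := Set.mem_iUnion.1 (hdom m t ((hs.isSome_reg2 m t).2 ⟨all m, h⟩) hxm)
      exact Set.mem_iUnion.2 ⟨k, Or.inr hk⟩
  disjoint := hs.disjoint
  cost_le i := by
    refine (cost_le_iff hr i (s.first i)).2 fun p hp x hx => ?_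
    obtain ⟨t, ht, hp⟩ := Set.mem_iUnion₂.1 hp
    obtain ⟨u, hu, hx⟩ := Set.mem_iUnion₂.1 hx
    have hp1 : p ∈ (s.reg1 i t).getD ∅ := hp.resolve_right fun h =>
      notMem_side_not ht ((hs.isSome_reg2 i t).1 (isSome_of_mem_getD h)).2
    have hx2 : x ∈ (s.reg2 i u).getD ∅ := hx.resolve_left fun h =>
      notMem_side_not ((hs.isSome_reg1 i u).1 (isSome_of_mem_getD h)).2 hu
    exact hs.le_geoDist i t ht u p hp1 x hx2

/-! ### Executions -/

/-- What holds in every reachable state. -/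
def Sound (D : Deployment T ι) (r : ℝ) (s : State ι (Finset (Fin n))) : Prop :=
  s.status = Status.running → D.Consistent r s ∧ D.Saturated s

/-- What holds in every reachable state if `A` is a feasible allocation. -/
def SoundFor (D : Deployment T ι) (r : ℝ) (A : ι → Finset (Fin n) → Set Plane)
    (s : State ι (Finset (Fin n))) : Prop :=
  match s.status with
  | Status.running => Dominates A s
  | Status.impossible => False
  | Status.allocated => D.IsFeasible r s.regions

theorem IsInitial.sound (h : D.IsInitial s) : D.Sound r s :=
  fun _ => ⟨consistent_blank.update h, h.saturated⟩

theorem IsInitial.soundFor (h : D.IsInitial s) : D.SoundFor r A s := by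
  have hdom : Dominates A s := Dominates.update (fun _ _ h => by simp [blank] at h) h
  obtain ⟨f, -, -, rfl⟩ := h
  exact hdom

theorem Step.sound (hD : IsForest D.guardAdjacencyGraph) (hs : D.Sound r s)
    (h : D.Step r s s') : D.Sound r s' := by
  intro hrun
  cases h with
  | serve _ i running mem ok update =>
    exact ⟨((hs running).1.served mem).update update, update.saturated⟩
  | fail i running mem found => cases hrun
  | arbit _ i a running noReady unallocated update =>
    exact ((hs running).1.false_of_ready_eq_empty hD (hs running).2 noReady unallocated).elim
  | finish running noReady all => cases hrun

theorem Step.soundFor (hD : IsForest D.guardAdjacencyGraph) (hr : 0 < r) (hA : D.IsFeasible r A)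
    (hs : D.Sound r s) (hsA : D.SoundFor r A s) (h : D.Step r s s') : D.SoundFor r A s' := by
  have hdom : s.status = Status.running → Dominates A s := by
    intro hrun
    simpa only [SoundFor, hrun] using hsA
  cases h with
  | serve _ i running mem ok update =>
    have hdom' := ((hdom running).served hr hA (hs running).1 mem).update update
    obtain ⟨f, -, -, rfl⟩ := update
    have hrun : (D.localloc r s i).status = Status.running := running
    simpa only [SoundFor, hrun] using hdom'
  | fail i running mem found =>
    exact (hdom running).localloc_succeeds hr hA (hs running).1 mem found
  | arbit _ i a running noReady unallocated update =>
    exact ((hs running).1.false_of_ready_eq_empty hD (hs running).2 noReady unallocated).elim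
  | finish running noReady all =>
    have hfeas : D.IsFeasible r s.regions := (hs running).1.isFeasible hr hA (hdom running) all
    exact hfeas

theorem Reachable.sound (hD : IsForest D.guardAdjacencyGraph) (h : D.Reachable r s) :
    D.Sound r s := by
  obtain ⟨s₀, h₀, h⟩ := h
  induction h with
  | refl => exact h₀.sound
  | tail _ h ih => exact h.sound hD ih

theorem Reachable.soundFor (hD : IsForest D.guardAdjacencyGraph) (hr : 0 < r)
    (hA : D.IsFeasible r A) (h : D.Reachable r s) : D.SoundFor r A s := by
  obtain ⟨s₀, h₀, h⟩ := h
  induction h with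
  | refl => exact h₀.soundFor
  | tail h' h ih => exact h.soundFor hD hr hA (Reachable.sound hD ⟨s₀, h₀, h'⟩) ih

theorem Step.status_eq_running (h : D.Step r s s') : s.status = Status.running := by
  cases h <;> assumption

theorem exists_step (h : s.status = Status.running) : ∃ s', D.Step r s s' := by
  rcases s.ready.eq_empty_or_nonempty with hempty | ⟨i, hi⟩
  · by_cases all : ∀ i, i ∈ s.alloc
    · exact ⟨_, Step.finish s h hempty all⟩
    · obtain ⟨i, hi⟩ := not_forall.1 all
      obtain ⟨s', hs'⟩ := D.exists_update _
      exact ⟨s', Step.arbit s s' i false h hempty hi hs'⟩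
  · by_cases hfound : D.Stop (D.localloc r s i) i
    · exact ⟨_, Step.fail s i h hi hfound⟩
    · obtain ⟨s', hs'⟩ := D.exists_update _
      exact ⟨s', Step.serve s s' i h hi hfound hs'⟩

/-- In a forest, each step that does not halt the execution allocates a guard. -/
theorem Step.alloc_ssubset (hD : IsForest D.guardAdjacencyGraph) (hs : D.Sound r s)
    (h : D.Step r s s') (hrun : s'.status = Status.running) : s.alloc ⊂ s'.alloc := by
  cases h with
  | serve _ i running mem ok update =>
    obtain ⟨f, -, -, rfl⟩ := update
    exact Set.ssubset_insert ((hs running).1.notMem_alloc i mem)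
  | fail i running mem found => cases hrun
  | arbit _ i a running noReady unallocated update =>
    exact ((hs running).1.false_of_ready_eq_empty hD (hs running).2 noReady unallocated).elim
  | finish running noReady all => cases hrun

theorem terminates (hD : IsForest D.guardAdjacencyGraph) : D.Terminates r := by
  rintro ⟨f, h₀, hf⟩
  have := D.finite_guards
  have hreach : ∀ m, D.Reachable r (f m) := by
    intro m
    refine ⟨f 0, h₀, ?_⟩
    induction m with
    | zero => exact .refl
    | succ m ih => exact ih.tail (hf m)
  have hmono : StrictMono fun m => (f m).alloc := strictMono_nat_of_lt_succ fun m =>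
    (hf m).alloc_ssubset hD ((hreach m).sound hD) (hf (m + 1)).status_eq_running
  exact not_injective_infinite_finite _ hmono.injective

end Deployment

end GuardTracking

theorem mainTheorem2 {n : ℕ} (P : Polygon GuardTracking.Plane n)
    (hP : GuardTracking.IsSimplePolygon P) (T : GuardTracking.Triangulation P)
    {ι : Type*} (D : GuardTracking.Deployment T ι) (r : ℝ) (hr : 0 < r)
    (hforest : GuardTracking.IsForest D.guardAdjacencyGraph) :
    D.GenallocComplete r := by
  refine ⟨D.exists_update _, GuardTracking.Deployment.terminates hforest, ?_⟩
  rintro ⟨A, hA⟩ s hs hmax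
  have h := hs.soundFor hforest hr hA
  unfold GuardTracking.Deployment.SoundFor at h
  split at h
  · next hrun => exact absurd (GuardTracking.Deployment.exists_step hrun) hmax
  · exact h.elim
  · next hstatus => exact ⟨hstatus, h⟩
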